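/- Consider a network of $n\ge 1$ sensor nodes $\mathcal V$ in $\mathbb R^D$ and finitely many measured anchors $a_k$ per node, with connected undirected measurement graph $\mathcal G=(\mathcal V,\mathcal E)$, neighbourhoods $\mathcal N_i$, anchor neighbourhoods $\mathcal N_{i,\mathrm a}$, range measurements $r_{i,j}$, $v_{i,k}$, and sensing densities $p_{i,j}(d\mid r_{i,j})$, $p_{i,k,\mathrm a}(e\mid v_{i,k})$ that are log-concave functions of the distances $d,e\ge 0$. For an edge $(i,j)$ let $z_{i,j}=(Y_{ii},Y_{jj},Y_{ij},\delta_{i,j},d_{i,j},x_i,x_j)\in\mathbb R^{5+2D}$ (with $z_{j,i}$ identified with $z_{i,j}$) and let $\mathcal Z_{i,j}$ be the set of such vectors with $$Y_{ii}+Y_{jj}-2Y_{ij}=\delta_{i,j}\ge 0,\quad \begin{pmatrix}1&d_{i,j}\\ d_{i,j}&\delta_{i,j}\end{pmatrix}\succeq 0,\quad d_{i,j}\ge 0,\quad \begin{pmatrix} I_D&x_i&x_j\\ x_i^{\mathsf T}&Y_{ii}&Y_{ij}\\ x_j^{\mathsf T}&Y_{ij}&Y_{jj}\end{pmatrix}\succeq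 0 .$$ Let $\mathbf p_i=(\epsilon_i,e_i,Y_{ii},x_i)$ and let $\mathcal P_i$ be the set of such vectors with, for all $k\in\mathcal N_{i,\mathrm a}$, $Y_{ii}-2x_i^{\mathsf T}a_k+\|a_k\|^2=\epsilon_{i,k}\ge 0$, $\begin{pmatrix}1&e_{i,k}\\ e_{i,k}&\epsilon_{i,k}\end{pmatrix}\succeq 0$, $e_{i,k}\ge 0$. Node $i$ has its own copies $y_i^i=(y^i_{i,j})_{j\in\mathcal N_i}$ of the vectors $z_{i,j}$; the entries $Y_{ii}$ and $x_i$ are the same in $\mathbf p_i$ and in all $y^i_{i,j}$. Let $$f_i(y_i^i,\mathbf p_i)=-\sum_{j\in\mathcal N_i}w_{i,j}\ln p_{i,j}(d_{i,j}\mid r_{i,j})-\sum_{k\in\mathcal N_{i,\mathrm a}}\ln p_{i,k,\mathrm a}(e_{i,k}\mid v_{i,k}),$$ where $-\ln 0=+\infty$, $0\cdot(+\infty)=0$, and $w_{i,j}\ge 0$, $w_{i,j}+w_{j,i}=1$ is any way to share the cost of an edge between its end points. The edge-based maximum likelihood relaxation is the convex problem $$\min\ \sum_{i\in\mathcal V}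 f_i(y_i^i,\mathbf p_i)\quad\text{subject to } y^i_{i,j},y^j_{i,j}\in\mathcal Z_{i,j},\ \mathbf p_i\in\mathcal P_i,\ y^i_{i,j}=z_{i,j},\ y^j_{i,j}=z_{i,j}.$$ Assume that it has a primal-dual solution $(q^*,\lambda^*)$ (a saddle point of the Lagrangian, of finite cost), where $\lambda^i_{i,j}$ is the multiplier of $y^i_{i,j}=z_{i,j}$; write $q_i=(y_i^i,\mathbf p_i,z_i)$, $z_i=(z_{i,j})_{j\in\mathcal N_i}$, $\lambda_i^i=(\lambda_{i,j}^i)_{j\in\mathcal N_i}$. For $\rho>0$ let $$\mathcal L_i(q_i,\lambda_i^i)=f_i(y_i^i,\mathbf p_i)+\sum_{j\in\mathcal N_i}\Big[\lambda_{i,j}^{i\,\mathsf T}y_{i,j}^i+\tfrac{\rho}{2}\|y_{i,j}^i-z_{i,j}\|_2^2\Big].$$ Let $(q^{(t)},\lambda^{(t)})$ be generated by the distributed ADMM algorithm started from $z^{(0)}=0$, $\lambda^{(0)}=0$: for $t\ge 0$, $(y_i^{i\,(t+1)},\mathbf p_i^{(t+1)})$ minimizes $\mathcal L_i(y_i^i,\mathbf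 p_i,z_i^{(t)},\lambda_i^{i\,(t)})$ over the constraints of node $i$ (the memberships in $\mathcal Z_{i,j}$, $\mathcal P_i$ and the common entries $Y_{ii},x_i$), $z_{i,j}^{(t+1)}=\tfrac12\big(y_{i,j}^{i\,(t+1)}+y_{i,j}^{j\,(t+1)}\big)$, and $\lambda_{i,j}^{i\,(t+1)}=\lambda_{i,j}^{i\,(t)}+\rho\big(y_{i,j}^{i\,(t+1)}-z_{i,j}^{(t+1)}\big)$. Let $\bar q_{i,t}=\frac1t\sum_{\kappa=1}^{t}q_i^{(\kappa)}$ be the running average of the iterates produced by $t$ iterations. Let $\eta>0$. Then for every number of iterations $$t\ \ge\ t_\eta:=\max_{i\in\mathcal V}\left\lceil\frac{1}{2\rho\eta}\left(\rho^2\|z_i^*\|_2^2+\|\lambda_i^{i*}\|_2^2\right)+1\right\rceil$$ the average local accuracy $\eta$ is reached: $$0\le\frac1n\sum_{i\in\mathcal V}\left(\mathcal L_i(\bar q_{i,t},\lambda_i^{i*})-\mathcal L_i(q_i^*,\lambda_i^{i*})\right)\le\eta .$$ Moreover $t_\eta$ does not depend on the network size $n$, but only on $\rho$, $\eta$ and the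 worst local initial error: $t_\eta=\lceil B/(2\rho\eta)+1\rceil$ with $B=\max_i\left(\rho^2\|z_i^*\|_2^2+\|\lambda_i^{i*}\|_2^2\right)$. -/

import Mathlib

open scoped BigOperators

noncomputable section

namespace SNL

/-! ## Variables -/

/-- Index set of the coordinates of a shared vector
`z_{i,j} = (Y_ii, Y_jj, Y_ij, δ_ij, d_ij, x_i, x_j) ∈ ℝ^(5+2D)`. -/
abbrev EdgeIdx (D : ℕ) : Type := Fin 5 ⊕ (Fin D ⊕ Fin D)

/-- The space `ℝ^(5+2D)` of shared vectors, with its Euclidean norm. -/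
abbrev EdgeVec (D : ℕ) : Type := EuclideanSpace ℝ (EdgeIdx D)

namespace EdgeVec
variable {D : ℕ}

/-- The coordinate `Y_ii`. -/
def Yii (z : EdgeVec D) : ℝ := z (Sum.inl 0)
/-- The coordinate `Y_jj`. -/
def Yjj (z : EdgeVec D) : ℝ := z (Sum.inl 1)
/-- The coordinate `Y_ij`. -/
def Yij (z : EdgeVec D) : ℝ := z (Sum.inl 2)
/-- The coordinate `δ_ij` (squared distance). -/
def sqd (z : EdgeVec D) : ℝ := z (Sum.inl 3)
/-- The coordinate `d_ij` (distance). -/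
def dst (z : EdgeVec D) : ℝ := z (Sum.inl 4)
/-- The block `x_i`. -/
def xi (z : EdgeVec D) : EuclideanSpace ℝ (Fin D) :=
  WithLp.toLp 2 fun a => z (Sum.inr (Sum.inl a))
/-- The block `x_j`. -/
def xj (z : EdgeVec D) : EuclideanSpace ℝ (Fin D) :=
  WithLp.toLp 2 fun a => z (Sum.inr (Sum.inr a))

/-- The reordering of the coordinates that exchanges the roles of the two end points of an edge. -/
def swapIdx (D : ℕ) : EdgeIdx D ≃ EdgeIdx D :=
  Equiv.sumCongr (Equiv.swap 0 1) (Equiv.sumComm (Fin D) (Fin D))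

/-- The same shared vector, listed from the point of view of the other end point of the edge:
`(Y_ii, Y_jj, Y_ij, δ, d, x_i, x_j)` becomes `(Y_jj, Y_ii, Y_ij, δ, d, x_j, x_i)`.
It identifies `z_{j,i}` with `z_{i,j}`. -/
def swap : EdgeVec D ≃ₗᵢ[ℝ] EdgeVec D :=
  LinearIsometryEquiv.piLpCongrLeft 2 ℝ ℝ (swapIdx D)

/-- The set `Z_{i,j}` of shared vectors satisfying the edge constraints
`Y_ii + Y_jj - 2 Y_ij = δ`, `δ ≥ 0`, `[1 d; d δ] ⪰ 0`, `d ≥ 0` and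
`[I x_i x_j; x_iᵀ Y_ii Y_ij; x_jᵀ Y_ij Y_jj] ⪰ 0`. -/
def feasible (D : ℕ) : Set (EdgeVec D) :=
  {z | z.Yii + z.Yjj - 2 * z.Yij = z.sqd ∧ 0 ≤ z.sqd ∧
    (!![1, z.dst; z.dst, z.sqd] : Matrix (Fin 2) (Fin 2) ℝ).PosSemidef ∧ 0 ≤ z.dst ∧
    (Matrix.fromBlocks (1 : Matrix (Fin D) (Fin D) ℝ)
      (Matrix.of fun a b => (![z.xi, z.xj] : Fin 2 → EuclideanSpace ℝ (Fin D)) b a)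
      (Matrix.of fun b a => (![z.xi, z.xj] : Fin 2 → EuclideanSpace ℝ (Fin D)) b a)
      !![z.Yii, z.Yij; z.Yij, z.Yjj]).PosSemidef}

end EdgeVec

/-- The space of local vectors `p_i = (ε_i, e_i, Y_ii, x_i)`. The blocks `ε_i`, `e_i` are indexed by
all anchors; only their entries at the anchors measured by node `i` are ever used. -/
abbrev LocalVec (K : Type*) (D : ℕ) : Type _ :=
  (K → ℝ) × (K → ℝ) × ℝ × EuclideanSpace ℝ (Fin D)

namespace LocalVec
variable {K : Type*} {D : ℕ}

/-- The block of the `ε_{i,k}` (squared distances to anchors). -/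
def sqe (p : LocalVec K D) : K → ℝ := p.1
/-- The block of the `e_{i,k}` (distances to anchors). -/
def dste (p : LocalVec K D) : K → ℝ := p.2.1
/-- The coordinate `Y_ii`. -/
def Yii (p : LocalVec K D) : ℝ := p.2.2.1
/-- The block `x_i`. -/
def xi (p : LocalVec K D) : EuclideanSpace ℝ (Fin D) := p.2.2.2

end LocalVec

/-- The variables `q_i = (y_i^i, p_i, z_i)` owned by one node: its copies `y_{i,j}^i` of the shared
vectors, its local vector `p_i`, and the shared vectors `z_{i,j}`. The families in `j` are indexed by
all nodes; only their entries at the neighbours of `i` are ever used. -/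
abbrev NodeVars (V K : Type*) (D : ℕ) : Type _ :=
  (V → EdgeVec D) × LocalVec K D × (V → EdgeVec D)

namespace NodeVars
variable {V K : Type*} {D : ℕ}

/-- The copies `y_{i,j}^i`. -/
def y (q : NodeVars V K D) : V → EdgeVec D := q.1
/-- The local vector `p_i`. -/
def p (q : NodeVars V K D) : LocalVec K D := q.2.1
/-- The shared vectors `z_{i,j}`. -/
def z (q : NodeVars V K D) : V → EdgeVec D := q.2.2

end NodeVars

/-! ## Log-concave likelihoods -/

/-- `g` is a non-negative log-concave function of a distance, i.e. on `[0, ∞)`. -/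
def LogConcave (g : ℝ → ℝ) : Prop :=
  (∀ s, 0 ≤ s → 0 ≤ g s) ∧
  ∀ s s' a b : ℝ, 0 ≤ s → 0 ≤ s' → 0 < a → 0 < b → a + b = 1 →
    g s ^ a * g s' ^ b ≤ g (a * s + b * s')

/-- The negative logarithm `-ln u` of a likelihood value `u ≥ 0`, with `-ln 0 = +∞`. -/
def negLog (u : ℝ) : EReal := if 0 < u then ((-Real.log u : ℝ) : EReal) else ⊤

/-! ## The network and its edge-based maximum likelihood relaxation -/

/-- The data of a sensor network localization problem in `ℝ^D` with set of sensor nodes `V` and set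
of anchors `K`. The likelihoods and the measurements belong to undirected edges. -/
structure Network (V K : Type*) (D : ℕ) where
  /-- the graph of the inter-sensor measurements -/
  graph : SimpleGraph V
  /-- the anchors from which a node has a range measurement -/
  anchorNbr : V → Finset K
  /-- the positions of the anchors -/
  anchor : K → EuclideanSpace ℝ (Fin D)
  /-- `pdf i j d r` is the sensing density `p_{i,j}(d | r)` -/
  pdf : V → V → ℝ → ℝ → ℝ
  /-- the range measurements `r_{i,j}` -/
  meas : V → V → ℝ
  /-- `pdfA i k e v` is the sensing density `p_{i,k,a}(e | v)` -/
  pdfA : V → K → ℝ → ℝ → ℝ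
  /-- the range measurements `v_{i,k}` to anchors -/
  measA : V → K → ℝ
  pdf_symm : ∀ i j, pdf i j = pdf j i
  meas_symm : ∀ i j, meas i j = meas j i

namespace Network
variable {V K : Type*} [Fintype V] {D : ℕ} (N : Network V K D)

open scoped Classical in
/-- The set `N_i` of neighbours of node `i`. -/
def nbr (i : V) : Finset V := Finset.univ.filter fun j => N.graph.Adj i j

/-- The sensing densities are log-concave functions of the unknown distances. -/
def LogConcaveSensing : Prop :=
  (∀ i, ∀ j ∈ N.nbr i, LogConcave fun d => N.pdf i j d (N.meas i j)) ∧
  ∀ i, ∀ k ∈ N.anchorNbr i, LogConcave fun e => N.pdfA i k e (N.measA i k)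

/-- The set `P_i` of local vectors satisfying, for all anchors `k` measured by node `i`,
`Y_ii - 2 x_iᵀ a_k + ‖a_k‖² = ε`, `ε ≥ 0`, `[1 e; e ε] ⪰ 0`, `e ≥ 0`. -/
def anchorFeasible (i : V) : Set (LocalVec K D) :=
  {p | ∀ k ∈ N.anchorNbr i,
    p.Yii - 2 * inner ℝ p.xi (N.anchor k) + ‖N.anchor k‖ ^ 2 = p.sqe k ∧ 0 ≤ p.sqe k ∧
    (!![1, p.dste k; p.dste k, p.sqe k] : Matrix (Fin 2) (Fin 2) ℝ).PosSemidef ∧ 0 ≤ p.dste k}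

/-- The constraints on the pair `(y_i^i, p_i)` of node `i`: `y_{i,j}^i ∈ Z_{i,j}` for all neighbours
`j`, and `p_i ∈ P_i`. The node has one position `x_i` and one entry `Y_ii`: they are the same in
`p_i` and in all its `y_{i,j}^i`. -/
def nodeFeasible (i : V) (y : V → EdgeVec D) (p : LocalVec K D) : Prop :=
  (∀ j ∈ N.nbr i, y j ∈ EdgeVec.feasible D) ∧ p ∈ N.anchorFeasible i ∧
  ∀ j ∈ N.nbr i, (y j).Yii = p.Yii ∧ (y j).xi = p.xi

/-- `w` says how the cost `-ln p_{i,j}` of each edge is shared between its two end points. -/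
def IsCostSplit (w : V → V → ℝ) : Prop :=
  ∀ i j, N.graph.Adj i j → 0 ≤ w i j ∧ w i j + w j i = 1

/-- The local cost `f_i(y_i^i, p_i)`. The sum of the `f_i` at common copies is
`- ∑_{edges} ln p_{i,j}(d_{i,j} | r_{i,j}) - ∑_{anchor edges} ln p_{i,k,a}(e_{i,k} | v_{i,k})`. -/
def localCost (w : V → V → ℝ) (i : V) (y : V → EdgeVec D) (p : LocalVec K D) : EReal :=
  (∑ j ∈ N.nbr i, (w i j : EReal) * negLog (N.pdf i j (y j).dst (N.meas i j))) +
    ∑ k ∈ N.anchorNbr i, negLog (N.pdfA i k (p.dste k) (N.measA i k))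

/-- All nodes agree about the shared vectors: `z_{j,i}` and `z_{i,j}` are the same vector, up to the
order in which its coordinates are listed. -/
def SharedConsistent (q : V → NodeVars V K D) : Prop :=
  ∀ i, ∀ j ∈ N.nbr i, (q j).z i = EdgeVec.swap ((q i).z j)

/-- The Lagrangian of the problem
`minimize ∑_i f_i(y_i^i, p_i)` subject to `y_{i,j}^i ∈ Z_{i,j}`, `p_i ∈ P_i`,
`y_{i,j}^i = z_{i,j} = y_{i,j}^j`, with one multiplier for each equality constraint.
Here `la i j` is `λ_{i,j}^i`; the pair `(j, i)` contributes the term of `λ_{i,j}^j`. -/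
def lagrangian (w : V → V → ℝ) (q : V → NodeVars V K D) (la : V → V → EdgeVec D) : EReal :=
  (∑ i, N.localCost w i (q i).y (q i).p) +
    ((∑ i, ∑ j ∈ N.nbr i, inner ℝ (la i j) ((q i).y j - (q i).z j) : ℝ) : EReal)

/-- `(q, la)` is a primal-dual solution of this problem: `q` satisfies all the constraints and has
finite cost, and `la` is a vector of Lagrange multipliers, i.e. `q` minimizes the Lagrangian with
multipliers `la` when the equality constraints are dropped (so `(q, la)` is a saddle point). -/
def IsSolution (w : V → V → ℝ) (q : V → NodeVars V K D) (la : V → V → EdgeVec D) : Prop :=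
  (∀ i, N.nodeFeasible i (q i).y (q i).p) ∧
  N.SharedConsistent q ∧
  (∀ i, ∀ j ∈ N.nbr i, (q i).y j = (q i).z j) ∧
  (∀ i, N.localCost w i (q i).y (q i).p ≠ ⊤) ∧
  ∀ q' : V → NodeVars V K D, (∀ i, N.nodeFeasible i (q' i).y (q' i).p) → N.SharedConsistent q' →
    N.lagrangian w q la ≤ N.lagrangian w q' la

/-- The local Lagrangian
`L_i(q_i, λ_i^i) = f_i(y_i^i, p_i) + ∑_{j ∈ N_i} (λ_{i,j}^iᵀ y_{i,j}^i + ρ/2 ‖y_{i,j}^i - z_{i,j}‖²)`. -/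
def localLagrangian (w : V → V → ℝ) (ρ : ℝ) (i : V) (q : NodeVars V K D) (la : V → EdgeVec D) :
    EReal :=
  N.localCost w i q.y q.p +
    ((∑ j ∈ N.nbr i, (inner ℝ (la j) (q.y j) + ρ / 2 * ‖q.y j - q.z j‖ ^ 2) : ℝ) : EReal)

/-- The sequences `q^(t)`, `λ^(t)` are generated by the distributed ADMM algorithm with exact local
minimizations, started from `z^(0) = 0` and `λ^(0) = 0`:
* `(y_i^(t+1), p_i^(t+1))` minimizes `L_i(y_i, p_i, z_i^(t), λ_i^(t))` over the constraints of node `i`;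
* `z_{i,j}^(t+1)` is the mean of the two copies `y_{i,j}^{i (t+1)}` and `y_{i,j}^{j (t+1)}`;
* `λ_{i,j}^{i (t+1)} = λ_{i,j}^{i (t)} + ρ (y_{i,j}^{i (t+1)} - z_{i,j}^(t+1))`. -/
def IsADMM (w : V → V → ℝ) (ρ : ℝ) (q : ℕ → V → NodeVars V K D) (la : ℕ → V → V → EdgeVec D) :
    Prop :=
  (∀ i, ∀ j ∈ N.nbr i, (q 0 i).z j = 0 ∧ la 0 i j = 0) ∧
  (∀ t i, N.nodeFeasible i (q (t + 1) i).y (q (t + 1) i).p ∧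
    ∀ y p, N.nodeFeasible i y p →
      N.localLagrangian w ρ i ((q (t + 1) i).y, (q (t + 1) i).p, (q t i).z) (la t i) ≤
        N.localLagrangian w ρ i (y, p, (q t i).z) (la t i)) ∧
  (∀ t i, ∀ j ∈ N.nbr i,
    (q (t + 1) i).z j =
      (1 / 2 : ℝ) • ((q (t + 1) i).y j + EdgeVec.swap ((q (t + 1) j).y i))) ∧
  ∀ t i, ∀ j ∈ N.nbr i,
    la (t + 1) i j = la t i j + ρ • ((q (t + 1) i).y j - (q (t + 1) i).z j)

/-- The running average of the iterates produced by `t` iterations of the algorithm,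
`(1/t) ∑_{κ=1}^{t} q_i^(κ)`. -/
def runningAverage (q : ℕ → V → NodeVars V K D) (t : ℕ) (i : V) : NodeVars V K D :=
  (1 / (t : ℝ)) • ∑ κ ∈ Finset.Icc 1 t, q κ i

/-- The average local accuracy
`(1/n) ∑_i (L_i(q_i, λ_i^{i*}) - L_i(q_i^*, λ_i^{i*}))` of a point `q`. -/
def averageLocalGap (w : V → V → ℝ) (ρ : ℝ) (q qs : V → NodeVars V K D) (las : V → V → EdgeVec D) :
    EReal :=
  ((1 / (Fintype.card V : ℝ) : ℝ) : EReal) *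
    ∑ i, (N.localLagrangian w ρ i (q i) (las i) - N.localLagrangian w ρ i (qs i) (las i))

/-- The initial error `ρ² ‖z_i^*‖² + ‖λ_i^{i*}‖²` of node `i`. -/
def localError (ρ : ℝ) (qs : V → NodeVars V K D) (las : V → V → EdgeVec D) (i : V) : ℝ :=
  ρ ^ 2 * (∑ j ∈ N.nbr i, ‖(qs i).z j‖ ^ 2) + ∑ j ∈ N.nbr i, ‖las i j‖ ^ 2

/-- The number of iterations `t_η = max_i ⌈(ρ² ‖z_i^*‖² + ‖λ_i^{i*}‖²) / (2 ρ η) + 1⌉`. -/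
def iterationBound (ρ η : ℝ) (qs : V → NodeVars V K D) (las : V → V → EdgeVec D) : ℕ :=
  Finset.univ.sup fun i => ⌈1 / (2 * ρ * η) * N.localError ρ qs las i + 1⌉₊

end Network

end SNL

end

namespace SNL

/-! The proof is the ergodic O(1/t) analysis of ADMM. Let Φ = ‖λ - λ*‖²/(2ρ) + (ρ/2)‖z - z*‖²,
summed over all oriented edges. Convexity of the local problems turns each exact minimization into a
first-order inequality (`realCost_sub_le_of_isMin`); summing over the nodes and completing squares
(`potential_step`), one iteration lowers Φ by at least the summed gap of the local Lagrangians at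
the new iterate.

The cross terms vanish by parity. When the end points of an edge are exchanged, shared vectors are
even, whereas the residuals y - z and the running multipliers are odd, so they are orthogonal
(`IsConsistent.pairing_eq_zero`). The multiplier λ* is orthogonal to even families because z is free
in the saddle-point problem (`IsSolution.pairing_eq_zero`).

Telescoping and Jensen bound the gap at the running average by Φ₀/t. The zero start makes Φ₀ equal
to 1/(2ρ) times the sum of the local errors; division by n gives their mean, at most the worst one,
so n disappears. The lower bound is the saddle property, applicable because running averages stay
feasible, consistent and of finite cost. -/

/-! ### Extended-real sums and negative log-likelihoods -/

theorem EReal.coe_finset_sum {ι : Type*} (s : Finset ι) (f : ι → ℝ) :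
    ((∑ i ∈ s, f i : ℝ) : EReal) = ∑ i ∈ s, (f i : EReal) := by
  classical
  induction s using Finset.induction_on with
  | empty => simp
  | insert a s ha ih => rw [Finset.sum_insert ha, Finset.sum_insert ha, EReal.coe_add, ih]

theorem EReal.sum_ne_bot {ι : Type*} {s : Finset ι} {f : ι → EReal} (h : ∀ i ∈ s, f i ≠ ⊥) :
    ∑ i ∈ s, f i ≠ ⊥ := by
  classical
  induction s using Finset.induction_on with
  | empty => simp
  | insert a s ha ih =>
    rw [Finset.sum_insert ha]
    exact EReal.add_ne_bot_iff.2 ⟨h a (Finset.mem_insert_self a s),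
      ih fun i hi => h i (Finset.mem_insert_of_mem hi)⟩

theorem EReal.ne_top_of_sum_ne_top {ι : Type*} {s : Finset ι} {f : ι → EReal}
    (h : ∀ i ∈ s, f i ≠ ⊥) (hs : ∑ i ∈ s, f i ≠ ⊤) {i : ι} (hi : i ∈ s) : f i ≠ ⊤ := by
  classical
  rintro htop
  apply hs
  rw [← Finset.add_sum_erase s f hi, htop]
  exact EReal.top_add_of_ne_bot (EReal.sum_ne_bot fun j hj => h j (Finset.mem_of_mem_erase hj))

theorem negLog_of_pos {u : ℝ} (hu : 0 < u) : negLog u = ((-Real.log u : ℝ) : EReal) := if_pos hu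

theorem negLog_ne_bot (u : ℝ) : negLog u ≠ ⊥ := by
  unfold negLog
  split_ifs
  · exact EReal.coe_ne_bot _
  · simp

theorem pos_of_negLog_ne_top {u : ℝ} (h : negLog u ≠ ⊤) : 0 < u := by
  by_contra hu
  exact h (if_neg hu)

theorem coe_mul_negLog_ne_bot {a : ℝ} (ha : 0 ≤ a) (u : ℝ) : (a : EReal) * negLog u ≠ ⊥ := by
  rcases ha.eq_or_lt with rfl | ha
  · simp
  · unfold negLog
    split_ifs
    · rw [← EReal.coe_mul]
      exact EReal.coe_ne_bot _
    · rw [EReal.coe_mul_top_of_pos ha]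
      simp

/-- Taking logarithms in the log-concavity inequality. The restriction to `0 < g s` is needed
because `Real.log 0 = 0` is not the intended value; the same inequality shows that this set is
convex. -/
theorem LogConcave.convexOn_neg_log {g : ℝ → ℝ} (hg : LogConcave g) :
    ConvexOn ℝ {s | 0 ≤ s ∧ 0 < g s} fun s => -Real.log (g s) := by
  have key : ∀ s s' a b : ℝ, 0 ≤ s → 0 < g s → 0 ≤ s' → 0 < g s' → 0 < a → 0 < b → a + b = 1 →
      0 < g s ^ a * g s' ^ b ∧ g s ^ a * g s' ^ b ≤ g (a * s + b * s') :=
    fun s s' a b hs hgs hs' hgs' ha hb hab =>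
      ⟨mul_pos (Real.rpow_pos_of_pos hgs a) (Real.rpow_pos_of_pos hgs' b),
        hg.2 s s' a b hs hs' ha hb hab⟩
  rw [convexOn_iff_forall_pos, convex_iff_forall_pos]
  refine ⟨fun s hs s' hs' a b ha hb hab => ?_, fun s hs s' hs' a b ha hb hab => ?_⟩
  · obtain ⟨h1, h2⟩ := key s s' a b hs.1 hs.2 hs'.1 hs'.2 ha hb hab
    have h1s := hs.1
    have h1s' := hs'.1
    exact ⟨by positivity, h1.trans_le h2⟩
  · obtain ⟨h1, h2⟩ := key s s' a b hs.1 hs.2 hs'.1 hs'.2 ha hb hab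
    have h3 := Real.log_le_log h1 h2
    rw [Real.log_mul (Real.rpow_pos_of_pos hs.2 a).ne' (Real.rpow_pos_of_pos hs'.2 b).ne',
      Real.log_rpow hs.2, Real.log_rpow hs'.2] at h3
    simp only [smul_eq_mul]
    linarith

/-! ### Convexity of the constraint sets -/

theorem posSemidef_convexComb {n : Type*} {A B : Matrix n n ℝ} (hA : A.PosSemidef)
    (hB : B.PosSemidef) {a b : ℝ} (ha : 0 ≤ a) (hb : 0 ≤ b) : (a • A + b • B).PosSemidef :=
  (hA.smul ha).add (hB.smul hb)

/-- Every constraint is an affine equality, an affine inequality or an affine matrix inequality. The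
constant entries of the matrices are preserved because `a + b = 1`. -/
theorem convex_feasible (D : ℕ) : Convex ℝ (EdgeVec.feasible D) := by
  rintro z ⟨h1, h2, h3, h4, h5⟩ z' ⟨h1', h2', h3', h4', h5'⟩ a b ha hb hab
  have e1 : (a • z + b • z').Yii = a * z.Yii + b * z'.Yii := rfl
  have e2 : (a • z + b • z').Yjj = a * z.Yjj + b * z'.Yjj := rfl
  have e3 : (a • z + b • z').Yij = a * z.Yij + b * z'.Yij := rfl
  have e4 : (a • z + b • z').sqd = a * z.sqd + b * z'.sqd := rfl
  have e5 : (a • z + b • z').dst = a * z.dst + b * z'.dst := rfl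
  refine ⟨?_, ?_, ?_, ?_, ?_⟩
  · rw [e1, e2, e3, e4, ← h1, ← h1']
    ring
  · rw [e4]
    positivity
  · convert posSemidef_convexComb h3 h3' ha hb using 1
    ext i j
    fin_cases i <;> fin_cases j <;> simp [e4, e5, hab]
  · rw [e5]
    positivity
  · convert posSemidef_convexComb h5 h5' ha hb using 1
    ext i j
    rcases i with i | i <;> rcases j with j | j
    · simp [← add_mul, hab]
    · fin_cases j <;> simp [EdgeVec.xi, EdgeVec.xj]
    · fin_cases i <;> simp [EdgeVec.xi, EdgeVec.xj]
    · fin_cases i <;> fin_cases j <;> simp [e1, e2, e3]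

namespace Network
variable {V K : Type*} [Fintype V] {D : ℕ} (N : Network V K D)

theorem mem_nbr {i j : V} : j ∈ N.nbr i ↔ N.graph.Adj i j := by
  simp [nbr]

theorem mem_nbr_comm {i j : V} : j ∈ N.nbr i ↔ i ∈ N.nbr j := by
  simp [nbr, N.graph.adj_comm]

omit [Fintype V] in
theorem convex_anchorFeasible (i : V) : Convex ℝ (N.anchorFeasible i) := by
  intro p hp p' hp' a b ha hb hab k hk
  obtain ⟨h1, h2, h3, h4⟩ := hp k hk
  obtain ⟨h1', h2', h3', h4'⟩ := hp' k hk
  have e1 : (a • p + b • p').sqe k = a * p.sqe k + b * p'.sqe k := rfl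
  have e2 : (a • p + b • p').dste k = a * p.dste k + b * p'.dste k := rfl
  have e3 : (a • p + b • p').Yii = a * p.Yii + b * p'.Yii := rfl
  have e4 : (a • p + b • p').xi = a • p.xi + b • p'.xi := rfl
  refine ⟨?_, ?_, ?_, ?_⟩
  · rw [e1, e3, e4, inner_add_left, real_inner_smul_left, real_inner_smul_left, ← h1, ← h1']
    linear_combination (-‖N.anchor k‖ ^ 2) * hab
  · rw [e1]
    positivity
  · convert posSemidef_convexComb h3 h3' ha hb using 1
    ext i j
    fin_cases i <;> fin_cases j <;> simp [e1, e2, hab]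
  · rw [e2]
    positivity

/-! ### Finite costs and their convexity -/

/-- The local vectors `(y, p)` of node `i` have positive likelihood on the terms of positive
weight. -/
noncomputable def FiniteCost (w : V → V → ℝ) (i : V) (y : V → EdgeVec D) (p : LocalVec K D) : Prop :=
  (∀ j ∈ N.nbr i, w i j = 0 ∨ 0 < N.pdf i j (y j).dst (N.meas i j)) ∧
  ∀ k ∈ N.anchorNbr i, 0 < N.pdfA i k (p.dste k) (N.measA i k)

/-- The local cost as a real number, meaningful where it is finite. -/
noncomputable def realCost (w : V → V → ℝ) (i : V) (y : V → EdgeVec D) (p : LocalVec K D) : ℝ :=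
  (∑ j ∈ N.nbr i, w i j * -Real.log (N.pdf i j (y j).dst (N.meas i j))) +
    ∑ k ∈ N.anchorNbr i, -Real.log (N.pdfA i k (p.dste k) (N.measA i k))

variable {N}

theorem FiniteCost.localCost_eq {w : V → V → ℝ} {i : V} {y : V → EdgeVec D} {p : LocalVec K D}
    (h : N.FiniteCost w i y p) : N.localCost w i y p = (N.realCost w i y p : EReal) := by
  unfold localCost realCost
  rw [EReal.coe_add, EReal.coe_finset_sum, EReal.coe_finset_sum]
  congr 1
  · refine Finset.sum_congr rfl fun j hj => ?_
    rcases h.1 j hj with h0 | h0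
    · simp [h0]
    · rw [negLog_of_pos h0, EReal.coe_mul]
  · exact Finset.sum_congr rfl fun k hk => negLog_of_pos (h.2 k hk)

/-- No summand is `⊥`, so a single `⊤` would make the whole sum `⊤`. Terms of weight zero give no
information, since `0 * ⊤ = 0`. -/
theorem finiteCost_of_localCost_ne_top {w : V → V → ℝ} {i : V} (hw : ∀ j ∈ N.nbr i, 0 ≤ w i j)
    {y : V → EdgeVec D} {p : LocalVec K D} (h : N.localCost w i y p ≠ ⊤) :
    N.FiniteCost w i y p := by
  have b1 : ∀ j ∈ N.nbr i, (w i j : EReal) * negLog (N.pdf i j (y j).dst (N.meas i j)) ≠ ⊥ :=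
    fun j hj => coe_mul_negLog_ne_bot (hw j hj) _
  have b2 : ∀ k ∈ N.anchorNbr i, negLog (N.pdfA i k (p.dste k) (N.measA i k)) ≠ ⊥ :=
    fun k _ => negLog_ne_bot _
  refine ⟨fun j hj => ?_, fun k hk => ?_⟩
  · rcases (hw j hj).eq_or_lt with h0 | h0
    · exact Or.inl h0.symm
    · refine Or.inr (pos_of_negLog_ne_top fun htop => ?_)
      refine EReal.ne_top_of_sum_ne_top b1 (fun hs => h ?_) hj ?_
      · unfold localCost
        rw [hs, EReal.top_add_of_ne_bot (EReal.sum_ne_bot b2)]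
      · rw [htop, EReal.coe_mul_top_of_pos h0]
  · refine pos_of_negLog_ne_top (EReal.ne_top_of_sum_ne_top b2 (fun hs => h ?_) hk)
    unfold localCost
    rw [hs, EReal.add_top_of_ne_bot (EReal.sum_ne_bot b1)]

variable (N) in
/-- The feasible points of finite cost of node `i`. -/
noncomputable def domain (w : V → V → ℝ) (i : V) : Set (NodeVars V K D) :=
  {q | N.nodeFeasible i q.y q.p ∧ N.FiniteCost w i q.y q.p}

/-- Each summand is `-log` of a log-concave function composed with a linear coordinate. Edges of
weight zero are treated apart: there the likelihood may vanish, but the term is zero. -/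
theorem convexOn_realCost (hlog : N.LogConcaveSensing) {w : V → V → ℝ} {i : V}
    (hw : ∀ j ∈ N.nbr i, 0 ≤ w i j) :
    ConvexOn ℝ (N.domain w i) fun q => N.realCost w i q.y q.p := by
  have hc : Convex ℝ (N.domain w i) := by
    rintro q ⟨⟨f1, f2, f3⟩, c1, c2⟩ q' ⟨⟨f1', f2', f3'⟩, c1', c2'⟩ a b ha hb hab
    refine ⟨⟨fun j hj => convex_feasible D (f1 j hj) (f1' j hj) ha hb hab,
      N.convex_anchorFeasible i f2 f2' ha hb hab, fun j hj => ⟨?_, ?_⟩⟩, fun j hj => ?_,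
      fun k hk => ?_⟩
    · exact congrArg₂ (fun s s' : ℝ => a * s + b * s') (f3 j hj).1 (f3' j hj).1
    · exact congrArg₂ (fun s s' : EuclideanSpace ℝ (Fin D) => a • s + b • s')
        (f3 j hj).2 (f3' j hj).2
    · by_cases h0 : w i j = 0
      · exact Or.inl h0
      · exact Or.inr (((hlog.1 i j hj).convexOn_neg_log.1
          ⟨(f1 j hj).2.2.2.1, (c1 j hj).resolve_left h0⟩
          ⟨(f1' j hj).2.2.2.1, (c1' j hj).resolve_left h0⟩ ha hb hab).2)
    · exact ((hlog.2 i k hk).convexOn_neg_log.1 ⟨(f2 k hk).2.2.2, c2 k hk⟩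
        ⟨(f2' k hk).2.2.2, c2' k hk⟩ ha hb hab).2
  refine ⟨hc, ?_⟩
  rintro q ⟨⟨f1, f2, f3⟩, c1, c2⟩ q' ⟨⟨f1', f2', f3'⟩, c1', c2'⟩ a b ha hb hab
  simp only [realCost, smul_eq_mul, mul_add, Finset.mul_sum]
  rw [add_add_add_comm, ← Finset.sum_add_distrib, ← Finset.sum_add_distrib]
  refine add_le_add (Finset.sum_le_sum fun j hj => ?_) (Finset.sum_le_sum fun k hk => ?_)
  · by_cases h0 : w i j = 0
    · simp [h0]
    · have h := mul_le_mul_of_nonneg_left ((hlog.1 i j hj).convexOn_neg_log.2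
          ⟨(f1 j hj).2.2.2.1, (c1 j hj).resolve_left h0⟩
          ⟨(f1' j hj).2.2.2.1, (c1' j hj).resolve_left h0⟩ ha hb hab) (hw j hj)
      refine h.trans (le_of_eq ?_)
      simp only [smul_eq_mul]
      ring
  · exact (hlog.2 i k hk).convexOn_neg_log.2 ⟨(f2 k hk).2.2.2, c2 k hk⟩
        ⟨(f2' k hk).2.2.2, c2' k hk⟩ ha hb hab

end Network
end SNL

/-! ### First-order optimality of the local minimizations -/

namespace SNL

theorem EdgeVec.swap_swap {D : ℕ} (z : EdgeVec D) : EdgeVec.swap (EdgeVec.swap z) = z := by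
  ext i
  rcases i with i | i | i
  · fin_cases i <;> rfl
  · rfl
  · rfl

/-- Divide by `s` and let `s` tend to 0. This extracts the directional derivative without
differentiating the cost, which need not be smooth. -/
theorem nonneg_of_forall_mul_add_sq_mul {a c : ℝ}
    (h : ∀ s : ℝ, 0 < s → s ≤ 1 → 0 ≤ s * a + s ^ 2 * c) : 0 ≤ a := by
  by_contra! ha
  have hc : 0 < |c| + 1 := by positivity
  have hs : 0 < min 1 (-a / (2 * (|c| + 1))) := lt_min one_pos (by apply div_pos <;> linarith)
  -- With this bound `s * |c|` is less than `-a / 2`, so `a + s * c` is still negative.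
  obtain ⟨s, hs0, hs1, hs2⟩ : ∃ s : ℝ, 0 < s ∧ s ≤ 1 ∧ s ≤ -a / (2 * (|c| + 1)) :=
    ⟨_, hs, min_le_left _ _, min_le_right _ _⟩
  rw [le_div_iff₀ (by positivity)] at hs2
  have h1 : 0 ≤ s * (a + s * c) := by linarith [h s hs0 hs1]
  have h2 : 0 ≤ a + s * c := nonneg_of_mul_nonneg_right h1 hs0
  have h3 : s * c ≤ s * |c| := mul_le_mul_of_nonneg_left (le_abs_self c) hs0.le
  linarith

theorem norm_sq_add_smul {E : Type*} [NormedAddCommGroup E] [InnerProductSpace ℝ E] (x y : E)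
    (s : ℝ) : ‖x + s • y‖ ^ 2 = ‖x‖ ^ 2 + 2 * s * inner ℝ x y + s ^ 2 * ‖y‖ ^ 2 := by
  rw [norm_add_sq_real, real_inner_smul_right, norm_smul, mul_pow, Real.norm_eq_abs, sq_abs]
  ring

namespace Network
variable {V K : Type*} [Fintype V] {D : ℕ} (N : Network V K D)

/-- The quadratic part of the local Lagrangian. -/
noncomputable def penalty (ρ : ℝ) (i : V) (y z la : V → EdgeVec D) : ℝ :=
  ∑ j ∈ N.nbr i, (inner ℝ (la j) (y j) + ρ / 2 * ‖y j - z j‖ ^ 2)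

variable {N}

theorem FiniteCost.localLagrangian_eq {w : V → V → ℝ} {ρ : ℝ} {i : V} {q : NodeVars V K D}
    (h : N.FiniteCost w i q.y q.p) (la : V → EdgeVec D) :
    N.localLagrangian w ρ i q la =
      ((N.realCost w i q.y q.p + N.penalty ρ i q.y q.z la : ℝ) : EReal) := by
  rw [localLagrangian, h.localCost_eq, EReal.coe_add]
  rfl

theorem finiteCost_of_localLagrangian_ne_top {w : V → V → ℝ} {ρ : ℝ} {i : V}
    (hw : ∀ j ∈ N.nbr i, 0 ≤ w i j) {q : NodeVars V K D} {la : V → EdgeVec D}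
    (h : N.localLagrangian w ρ i q la ≠ ⊤) : N.FiniteCost w i q.y q.p := by
  refine finiteCost_of_localCost_ne_top hw fun htop => h ?_
  rw [localLagrangian, htop, EReal.top_add_coe]

/-- First-order optimality condition of an exact local minimization. -/
theorem realCost_sub_le_of_isMin (hlog : N.LogConcaveSensing) {w : V → V → ℝ} {ρ : ℝ} {i : V}
    (hw : ∀ j ∈ N.nbr i, 0 ≤ w i j) {z la : V → EdgeVec D} {q qs : NodeVars V K D}
    (hq : q ∈ N.domain w i) (hqs : qs ∈ N.domain w i)
    (hmin : ∀ q' ∈ N.domain w i, N.realCost w i q.y q.p + N.penalty ρ i q.y z la ≤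
      N.realCost w i q'.y q'.p + N.penalty ρ i q'.y z la) :
    N.realCost w i q.y q.p - N.realCost w i qs.y qs.p ≤
      ∑ j ∈ N.nbr i, inner ℝ (la j + ρ • (q.y j - z j)) (qs.y j - q.y j) := by
  rw [← sub_nonneg]
  -- Move from `q` towards `qs` by a fraction `s`: convexity bounds the change of the cost linearly
  -- in `s`, and the penalty expands exactly, with `c` as the coefficient of `s ^ 2`.
  apply nonneg_of_forall_mul_add_sq_mul
    (c := ∑ j ∈ N.nbr i, ρ / 2 * ‖qs.y j - q.y j‖ ^ 2)
  intro s hs0 hs1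
  have hF := convexOn_realCost hlog hw
  have hmem := hF.1 hq hqs (sub_nonneg.2 hs1) hs0.le (by ring)
  have hconv := hF.2 hq hqs (sub_nonneg.2 hs1) hs0.le (by ring)
  have h := hmin _ hmem
  simp only [smul_eq_mul] at hconv
  set q' := (1 - s) • q + s • qs with hq'
  have hy : ∀ j, q'.y j = q.y j + s • (qs.y j - q.y j) := by
    intro j
    have : q'.y j = (1 - s) • q.y j + s • qs.y j := rfl
    rw [this]
    module
  have hpen : N.penalty ρ i q'.y z la = N.penalty ρ i q.y z la +
      (s * (∑ j ∈ N.nbr i, inner ℝ (la j + ρ • (q.y j - z j)) (qs.y j - q.y j)) +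
        s ^ 2 * ∑ j ∈ N.nbr i, ρ / 2 * ‖qs.y j - q.y j‖ ^ 2) := by
    simp only [penalty, Finset.mul_sum]
    rw [← Finset.sum_add_distrib, ← Finset.sum_add_distrib]
    refine Finset.sum_congr rfl fun j _ => ?_
    rw [hy, add_sub_right_comm, norm_sq_add_smul, inner_add_right, real_inner_smul_right,
      inner_add_left, real_inner_smul_left]
    ring
  rw [hpen] at h
  linarith

/-! ### The edge pairing, parity and the potential inequality -/

variable (N)

/-- The Euclidean pairing of two families of vectors attached to the oriented edges. -/
noncomputable def pairing (a b : V → V → EdgeVec D) : ℝ := ∑ i, ∑ j ∈ N.nbr i, inner ℝ (a i j) (b i j)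

theorem pairing_comm (a b : V → V → EdgeVec D) : N.pairing a b = N.pairing b a := by
  simp only [pairing, real_inner_comm]

theorem pairing_add_left (a b c : V → V → EdgeVec D) :
    N.pairing (a + b) c = N.pairing a c + N.pairing b c := by
  simp only [pairing, Pi.add_apply, inner_add_left, Finset.sum_add_distrib]

theorem pairing_smul_left (r : ℝ) (a b : V → V → EdgeVec D) :
    N.pairing (r • a) b = r * N.pairing a b := by
  simp only [pairing, Pi.smul_apply, real_inner_smul_left, Finset.mul_sum]

theorem pairing_neg_left (a b : V → V → EdgeVec D) : N.pairing (-a) b = -N.pairing a b := by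
  simp only [pairing, Pi.neg_apply, inner_neg_left, Finset.sum_neg_distrib]

theorem pairing_sub_left (a b c : V → V → EdgeVec D) :
    N.pairing (a - b) c = N.pairing a c - N.pairing b c := by
  rw [sub_eq_add_neg, pairing_add_left, pairing_neg_left, sub_eq_add_neg]

theorem pairing_add_right (a b c : V → V → EdgeVec D) :
    N.pairing a (b + c) = N.pairing a b + N.pairing a c := by
  simp only [N.pairing_comm a, pairing_add_left]

theorem pairing_smul_right (r : ℝ) (a b : V → V → EdgeVec D) :
    N.pairing a (r • b) = r * N.pairing a b := by
  simp only [N.pairing_comm a, pairing_smul_left]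

theorem pairing_sub_right (a b c : V → V → EdgeVec D) :
    N.pairing a (b - c) = N.pairing a b - N.pairing a c := by
  simp only [N.pairing_comm a, pairing_sub_left]

theorem pairing_self (a : V → V → EdgeVec D) :
    N.pairing a a = ∑ i, ∑ j ∈ N.nbr i, ‖a i j‖ ^ 2 := by
  simp only [pairing, real_inner_self_eq_norm_sq]

theorem pairing_self_nonneg (a : V → V → EdgeVec D) : 0 ≤ N.pairing a a := by
  rw [pairing_self]
  positivity

variable {N} in
theorem pairing_congr {a a' b b' : V → V → EdgeVec D} (ha : ∀ i, ∀ j ∈ N.nbr i, a i j = a' i j)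
    (hb : ∀ i, ∀ j ∈ N.nbr i, b i j = b' i j) : N.pairing a b = N.pairing a' b' :=
  Finset.sum_congr rfl fun i _ => Finset.sum_congr rfl fun j hj => by rw [ha i j hj, hb i j hj]

theorem sum_nbr_comm (g : V → V → ℝ) :
    ∑ i, ∑ j ∈ N.nbr i, g i j = ∑ i, ∑ j ∈ N.nbr i, g j i :=
  Finset.sum_comm' fun i j => by simpa using N.mem_nbr_comm

/-- The families of edge vectors that are the same from both end points of each edge. -/
noncomputable def IsConsistent (h : V → V → EdgeVec D) : Prop :=
  ∀ i, ∀ j ∈ N.nbr i, h j i = EdgeVec.swap (h i j)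

variable {N}

theorem IsConsistent.add {a b : V → V → EdgeVec D} (ha : N.IsConsistent a)
    (hb : N.IsConsistent b) : N.IsConsistent (a + b) := fun i j hj => by
  simp [ha i j hj, hb i j hj]

theorem IsConsistent.smul {a : V → V → EdgeVec D} (ha : N.IsConsistent a) (r : ℝ) :
    N.IsConsistent (r • a) := fun i j hj => by
  simp [ha i j hj]

theorem IsConsistent.sub {a b : V → V → EdgeVec D} (ha : N.IsConsistent a)
    (hb : N.IsConsistent b) : N.IsConsistent (a - b) := fun i j hj => by
  simp [ha i j hj, hb i j hj]

/-- Reversing all edges permutes the summands, and `swap` is an isometry; an odd family against an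
even one therefore pairs to its own negative. -/
theorem IsConsistent.pairing_eq_zero {a h : V → V → EdgeVec D} (hh : N.IsConsistent h)
    (ha : ∀ i, ∀ j ∈ N.nbr i, a j i = -EdgeVec.swap (a i j)) : N.pairing a h = 0 := by
  have h1 : N.pairing a h = -N.pairing a h := by
    conv_lhs => rw [pairing, N.sum_nbr_comm]
    rw [pairing, ← Finset.sum_neg_distrib]
    refine Finset.sum_congr rfl fun i _ => ?_
    rw [← Finset.sum_neg_distrib]
    refine Finset.sum_congr rfl fun j hj => ?_
    rw [ha i j hj, hh i j hj, inner_neg_left, LinearIsometryEquiv.inner_map_map]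
  linarith

/-- One step of the alternating direction method decreases the potential
`‖λ - λ*‖² / (2ρ) + ρ/2 ‖z - z*‖²` by at least the gap of the Lagrangian, where `l`, `z` are the old
and `l'`, `z'` the new multipliers and shared vectors. -/
theorem potential_step {ρ : ℝ} (hρ : 0 < ρ) {l l' ls y z z' zs : V → V → EdgeVec D}
    (A : ℝ) (hA : A ≤ N.pairing (l + ρ • (y - z)) (zs - y))
    (o1 : N.pairing (y - z') (z' - zs) = 0) (o2 : N.pairing (y - z') (z - zs) = 0)
    (o3 : N.pairing l (z' - zs) = 0) (o4 : N.pairing ls (z' - zs) = 0)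
    (hupd : ∀ i, ∀ j ∈ N.nbr i, l' i j = l i j + ρ • (y i j - z' i j)) :
    A + N.pairing ls (y - zs) + ρ / 2 * N.pairing (y - z') (y - z') ≤
      (1 / (2 * ρ) * N.pairing (l - ls) (l - ls) + ρ / 2 * N.pairing (z - zs) (z - zs)) -
      (1 / (2 * ρ) * N.pairing (l' - ls) (l' - ls) + ρ / 2 * N.pairing (z' - zs) (z' - zs)) := by
  -- Everything is expressed by the new residual `u`, the new and old errors `c`, `e` of the shared
  -- vectors, and the old multiplier error `a`; the new multiplier error is `a + ρ • u`.
  obtain ⟨u, hu⟩ : ∃ u, u = y - z' := ⟨_, rfl⟩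
  obtain ⟨c, hc⟩ : ∃ c, c = z' - zs := ⟨_, rfl⟩
  obtain ⟨e, he⟩ : ∃ e, e = z - zs := ⟨_, rfl⟩
  obtain ⟨a, ha⟩ : ∃ a, a = l - ls := ⟨_, rfl⟩
  have hl : N.pairing (l' - ls) (l' - ls) = N.pairing (a + ρ • u) (a + ρ • u) := by
    apply pairing_congr <;> intro i j hj <;>
      simp only [Pi.sub_apply, Pi.add_apply, Pi.smul_apply, hupd i j hj, ha, hu] <;> abel
  have h1 : zs - y = -(u + c) := by rw [hu, hc]; abel
  have h2 : y - z = u + c - e := by rw [hu, hc, he]; abel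
  have h3 : y - zs = u + c := by rw [hu, hc]; abel
  have h4 : l = a + ls := by rw [ha]; abel
  rw [h1, h2, h4, N.pairing_comm _ (-_), pairing_neg_left] at hA
  rw [h4, ← hc] at o3
  rw [hl, h3, ← hu, ← hc, ← he, ← ha]
  rw [← hu, ← hc] at o1
  rw [← hu, ← he] at o2
  rw [← hc] at o4
  -- After the orthogonality relations, the slack beyond `hA` is exactly `ρ / 2` times this square,
  -- where `e - c = z - z'`.
  have hsq := mul_nonneg hρ.le (N.pairing_self_nonneg (e - c))
  simp only [pairing_add_left, pairing_add_right, pairing_sub_left, pairing_sub_right,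
    pairing_smul_left, pairing_smul_right] at *
  have s1 := N.pairing_comm c u
  have s2 := N.pairing_comm u a
  have s3 := N.pairing_comm c a
  have s4 := N.pairing_comm e u
  have s5 := N.pairing_comm e c
  have s6 := N.pairing_comm u ls
  have s7 := N.pairing_comm c ls
  simp only [s1, s2, s3, s4, s5, s6, s7, o1, o2, o4] at *
  have hid : 1 / (2 * ρ) * (N.pairing a a + ρ * N.pairing a u +
      ρ * (N.pairing a u + ρ * N.pairing u u)) =
      1 / (2 * ρ) * N.pairing a a + N.pairing a u + ρ / 2 * N.pairing u u := by
    field_simp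
    ring
  nlinarith

end Network
end SNL

/-! ### The Lagrangian gap and the saddle point -/

namespace SNL
namespace Network
variable {V K : Type*} [Fintype V] {D : ℕ} {N : Network V K D}

/-- The local Lagrangian as a real number, meaningful where it is finite. -/
noncomputable def realLagrangian (N : Network V K D) (w : V → V → ℝ) (ρ : ℝ) (i : V) (la : V → EdgeVec D)
    (q : NodeVars V K D) : ℝ :=
  N.realCost w i q.y q.p + N.penalty ρ i q.y q.z la

theorem convexOn_realLagrangian (hlog : N.LogConcaveSensing) {w : V → V → ℝ} {i : V}
    (hw : ∀ j ∈ N.nbr i, 0 ≤ w i j) {ρ : ℝ} (hρ : 0 ≤ ρ) (la : V → EdgeVec D) :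
    ConvexOn ℝ (N.domain w i) (N.realLagrangian w ρ i la) := by
  refine (convexOn_realCost hlog hw).add ⟨(convexOn_realCost hlog hw).1, ?_⟩
  intro q _ q' _ a b ha hb hab
  simp only [penalty, smul_eq_mul, Finset.mul_sum]
  rw [← Finset.sum_add_distrib]
  refine Finset.sum_le_sum fun j _ => ?_
  have hy : (a • q + b • q').y j = a • q.y j + b • q'.y j := rfl
  have hz : (a • q + b • q').z j = a • q.z j + b • q'.z j := rfl
  have hyz : a • q.y j + b • q'.y j - (a • q.z j + b • q'.z j) =
      a • (q.y j - q.z j) + b • (q'.y j - q'.z j) := by module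
  have h := ((convexOn_univ_norm (E := EdgeVec D)).pow (fun _ _ => norm_nonneg _) 2).2
    (Set.mem_univ (q.y j - q.z j)) (Set.mem_univ (q'.y j - q'.z j)) ha hb hab
  simp only [Pi.pow_apply, smul_eq_mul] at h
  rw [hy, hz, hyz, inner_add_right, real_inner_smul_right, real_inner_smul_right]
  have h' := mul_le_mul_of_nonneg_left h (div_nonneg hρ zero_le_two)
  linarith

/-- The sum over the nodes of the differences of the local Lagrangians at two points. -/
noncomputable def totalGap (N : Network V K D) (w : V → V → ℝ) (ρ : ℝ) (qs : V → NodeVars V K D)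
    (las : V → V → EdgeVec D) (q : V → NodeVars V K D) : ℝ :=
  ∑ i, (N.realLagrangian w ρ i (las i) (q i) - N.realLagrangian w ρ i (las i) (qs i))

theorem averageLocalGap_eq {w : V → V → ℝ} {ρ : ℝ} {q qs : V → NodeVars V K D}
    (las : V → V → EdgeVec D) (hq : ∀ i, N.FiniteCost w i (q i).y (q i).p)
    (hqs : ∀ i, N.FiniteCost w i (qs i).y (qs i).p) :
    N.averageLocalGap w ρ q qs las =
      ((1 / (Fintype.card V : ℝ) * N.totalGap w ρ qs las q : ℝ) : EReal) := by
  rw [averageLocalGap, EReal.coe_mul, totalGap, EReal.coe_finset_sum]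
  congr 1
  refine Finset.sum_congr rfl fun i _ => ?_
  rw [(hq i).localLagrangian_eq, (hqs i).localLagrangian_eq, EReal.coe_sub]
  rfl

/-- At `qs` the copies equal the shared vectors: its penalty vanishes, and `z*` may replace `y*` in
the linear term. This is the form that `potential_step` bounds. -/
theorem totalGap_eq {w : V → V → ℝ} {ρ : ℝ} {qs : V → NodeVars V K D}
    (hyz : ∀ i, ∀ j ∈ N.nbr i, (qs i).y j = (qs i).z j) (las : V → V → EdgeVec D)
    (q : V → NodeVars V K D) :
    N.totalGap w ρ qs las q =
      ∑ i, (N.realCost w i (q i).y (q i).p - N.realCost w i (qs i).y (qs i).p) +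
      N.pairing las ((fun i => (q i).y) - fun i => (qs i).z) +
      ρ / 2 * N.pairing ((fun i => (q i).y) - fun i => (q i).z)
        ((fun i => (q i).y) - fun i => (q i).z) := by
  rw [pairing_self, pairing, totalGap, Finset.mul_sum, ← Finset.sum_add_distrib,
    ← Finset.sum_add_distrib]
  refine Finset.sum_congr rfl fun i _ => ?_
  have h : N.penalty ρ i (q i).y (q i).z (las i) - N.penalty ρ i (qs i).y (qs i).z (las i) =
      ∑ j ∈ N.nbr i, inner ℝ (las i j) ((q i).y j - (qs i).z j) +
      ρ / 2 * ∑ j ∈ N.nbr i, ‖(q i).y j - (q i).z j‖ ^ 2 := by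
    rw [penalty, penalty, Finset.mul_sum, ← Finset.sum_sub_distrib, ← Finset.sum_add_distrib]
    refine Finset.sum_congr rfl fun j hj => ?_
    rw [hyz i j hj, sub_self, norm_zero, inner_sub_right]
    ring
  simp only [realLagrangian, Pi.sub_apply]
  linarith

theorem lagrangian_eq {w : V → V → ℝ} {q : V → NodeVars V K D}
    (hq : ∀ i, N.FiniteCost w i (q i).y (q i).p) (la : V → V → EdgeVec D) :
    N.lagrangian w q la = ((∑ i, N.realCost w i (q i).y (q i).p +
      N.pairing la ((fun i => (q i).y) - fun i => (q i).z) : ℝ) : EReal) := by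
  rw [lagrangian, EReal.coe_add, Finset.sum_congr rfl fun i _ => (hq i).localCost_eq,
    ← EReal.coe_finset_sum]
  rfl

theorem IsSolution.mem_domain {w : V → V → ℝ} (hw : ∀ i, ∀ j ∈ N.nbr i, 0 ≤ w i j)
    {qs : V → NodeVars V K D} {las : V → V → EdgeVec D} (hs : N.IsSolution w qs las) (i : V) :
    qs i ∈ N.domain w i :=
  ⟨hs.1 i, finiteCost_of_localCost_ne_top (hw i) (hs.2.2.2.1 i)⟩

/-- A saddle point minimizes the Lagrangian over the feasible points of finite cost. -/
theorem IsSolution.sum_realCost_le {w : V → V → ℝ} (hw : ∀ i, ∀ j ∈ N.nbr i, 0 ≤ w i j)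
    {qs : V → NodeVars V K D} {las : V → V → EdgeVec D} (hs : N.IsSolution w qs las)
    {q : V → NodeVars V K D} (hq : ∀ i, q i ∈ N.domain w i) (hc : N.SharedConsistent q) :
    ∑ i, N.realCost w i (qs i).y (qs i).p ≤ ∑ i, N.realCost w i (q i).y (q i).p +
      N.pairing las ((fun i => (q i).y) - fun i => (q i).z) := by
  have h := hs.2.2.2.2 q (fun i => (hq i).1) hc
  rw [lagrangian_eq (fun i => (hs.mem_domain hw i).2), lagrangian_eq (fun i => (hq i).2),
    EReal.coe_le_coe_iff] at h
  have h0 : N.pairing las ((fun i => (qs i).y) - fun i => (qs i).z) = 0 :=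
    Finset.sum_eq_zero fun i _ => Finset.sum_eq_zero fun j hj => by
      simp [hs.2.2.1 i j hj]
  linarith

/-- Optimal multipliers are orthogonal to the consistent families. -/
theorem IsSolution.pairing_eq_zero {w : V → V → ℝ} (hw : ∀ i, ∀ j ∈ N.nbr i, 0 ≤ w i j)
    {qs : V → NodeVars V K D} {las : V → V → EdgeVec D} (hs : N.IsSolution w qs las)
    {h : V → V → EdgeVec D} (hh : N.IsConsistent h) : N.pairing las h = 0 := by
  -- Shifting `z*` by `r • h` keeps consistency and all costs, and changes the Lagrangian by `-r`
  -- times the pairing. Minimality for both signs of `r` forces the pairing to be zero.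
  have key : ∀ r : ℝ, r * N.pairing las h ≤ 0 := by
    intro r
    have hz : N.IsConsistent fun i => (qs i).z := hs.2.1
    have := hs.sum_realCost_le hw (q := fun i => ((qs i).y, (qs i).p, (qs i).z + (r • h) i))
      (fun i => hs.mem_domain hw i) (hz.add (hh.smul r))
    have e : N.pairing las ((fun i => (qs i).y) - fun i => (qs i).z + (r • h) i) =
        N.pairing las (-r • h) :=
      pairing_congr (fun _ _ _ => rfl) fun i j hj => by simp [hs.2.2.1 i j hj]
    rw [pairing_smul_right] at e
    have e' : N.pairing las ((fun i => (qs i).y) - fun i => (qs i).z + (r • h) i) ≥ 0 :=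
      le_of_add_le_add_left ((add_zero _).trans_le this)
    linarith
  linarith [key 1, key (-1)]

/-- The linear term pairs `las` with `y - z*`, the saddle inequality with `y - z`. Both shared
families are consistent, hence invisible to `las`, and the penalty is non-negative. -/
theorem IsSolution.totalGap_nonneg {w : V → V → ℝ} (hw : ∀ i, ∀ j ∈ N.nbr i, 0 ≤ w i j) {ρ : ℝ}
    (hρ : 0 ≤ ρ) {qs : V → NodeVars V K D} {las : V → V → EdgeVec D} (hs : N.IsSolution w qs las)
    {q : V → NodeVars V K D} (hq : ∀ i, q i ∈ N.domain w i) (hc : N.SharedConsistent q) :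
    0 ≤ N.totalGap w ρ qs las q := by
  rw [totalGap_eq hs.2.2.1]
  have hz : N.IsConsistent fun i => (q i).z := hc
  have hzs : N.IsConsistent fun i => (qs i).z := hs.2.1
  have h1 := hs.sum_realCost_le hw hq hc
  have h2 := hs.pairing_eq_zero hw hz
  have h3 := hs.pairing_eq_zero hw hzs
  have h4 := mul_nonneg (div_nonneg hρ zero_le_two)
    (N.pairing_self_nonneg ((fun i => (q i).y) - fun i => (q i).z))
  rw [pairing_sub_right] at h1 ⊢
  rw [Finset.sum_sub_distrib]
  linarith

/-! ### Decrease of the potential along the iterates -/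

section ADMM
variable {w : V → V → ℝ} {ρ : ℝ} {q : ℕ → V → NodeVars V K D} {la : ℕ → V → V → EdgeVec D}

theorem IsADMM.sharedConsistent (hq : N.IsADMM w ρ q la) (t : ℕ) : N.SharedConsistent (q t) := by
  intro i j hj
  have hi := N.mem_nbr_comm.1 hj
  rcases t with _ | t
  · simp [(hq.1 i j hj).1, (hq.1 j i hi).1]
  · rw [hq.2.2.1 t i j hj, hq.2.2.1 t j i hi, map_smul, map_add, EdgeVec.swap_swap, add_comm]

/-- The residual at `i` is half the difference between its own copy and the swapped copy of `j`. -/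
theorem IsADMM.residual_antisymm (hq : N.IsADMM w ρ q la) (t : ℕ) {i j : V} (hj : j ∈ N.nbr i) :
    (q (t + 1) j).y i - (q (t + 1) j).z i =
      -EdgeVec.swap ((q (t + 1) i).y j - (q (t + 1) i).z j) := by
  rw [hq.2.2.1 t i j hj, hq.2.2.1 t j i (N.mem_nbr_comm.1 hj), map_sub, map_smul, map_add,
    EdgeVec.swap_swap]
  module

/-- The multipliers start at zero and accumulate multiples of antisymmetric residuals. -/
theorem IsADMM.multiplier_antisymm (hq : N.IsADMM w ρ q la) (t : ℕ) {i j : V}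
    (hj : j ∈ N.nbr i) : la t j i = -EdgeVec.swap (la t i j) := by
  have hi := N.mem_nbr_comm.1 hj
  induction t with
  | zero => simp [(hq.1 i j hj).2, (hq.1 j i hi).2]
  | succ t ih =>
    rw [hq.2.2.2 t i j hj, hq.2.2.2 t j i hi, ih, hq.residual_antisymm t hj, map_add, map_smul]
    module

/-- A minimizer does no worse than `q₀`, whose cost is finite. The index is `t + 1` because nothing
is required of the initial copies. -/
theorem IsADMM.mem_domain (hw : ∀ i, ∀ j ∈ N.nbr i, 0 ≤ w i j) (hq : N.IsADMM w ρ q la)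
    {i : V} {q₀ : NodeVars V K D} (h₀ : q₀ ∈ N.domain w i) (t : ℕ) :
    q (t + 1) i ∈ N.domain w i := by
  obtain ⟨hf, hmin⟩ := hq.2.1 t i
  have h := hmin q₀.y q₀.p h₀.1
  rw [FiniteCost.localLagrangian_eq (q := (q₀.y, q₀.p, (q t i).z)) h₀.2] at h
  exact ⟨hf, finiteCost_of_localLagrangian_ne_top
    (q := ((q (t + 1) i).y, (q (t + 1) i).p, (q t i).z)) (hw i)
    (ne_top_of_le_ne_top (EReal.coe_ne_top _) h)⟩

/-- The potential of the ergodic analysis of the algorithm. -/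
noncomputable def potential (N : Network V K D) (ρ : ℝ) (qs : V → NodeVars V K D) (las : V → V → EdgeVec D)
    (q : V → NodeVars V K D) (la : V → V → EdgeVec D) : ℝ :=
  1 / (2 * ρ) * N.pairing (la - las) (la - las) +
    ρ / 2 * N.pairing ((fun i => (q i).z) - fun i => (qs i).z)
      ((fun i => (q i).z) - fun i => (qs i).z)

theorem potential_nonneg (hρ : 0 < ρ) (qs : V → NodeVars V K D) (las : V → V → EdgeVec D)
    (q : V → NodeVars V K D) (la : V → V → EdgeVec D) : 0 ≤ N.potential ρ qs las q la :=
  add_nonneg (mul_nonneg (by positivity) (N.pairing_self_nonneg _))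
    (mul_nonneg (by positivity) (N.pairing_self_nonneg _))

/-- The summed local optimality conditions supply the bound on the cost difference in
`potential_step`; parity and the optimality of `las` supply its four orthogonality relations. -/
theorem IsADMM.totalGap_le (hlog : N.LogConcaveSensing) (hw : ∀ i, ∀ j ∈ N.nbr i, 0 ≤ w i j)
    (hρ : 0 < ρ) {qs : V → NodeVars V K D} {las : V → V → EdgeVec D}
    (hs : N.IsSolution w qs las) (hq : N.IsADMM w ρ q la) (t : ℕ) :
    N.totalGap w ρ qs las (q (t + 1)) ≤
      N.potential ρ qs las (q t) (la t) - N.potential ρ qs las (q (t + 1)) (la (t + 1)) := by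
  have hzs : N.IsConsistent fun i => (qs i).z := hs.2.1
  have hz : ∀ t, N.IsConsistent fun i => (q t i).z := hq.sharedConsistent
  rw [totalGap_eq hs.2.2.1]
  refine potential_step hρ _ ?_ ?_ ?_ ?_ ?_ (hq.2.2.2 t)
  · rw [pairing]
    refine Finset.sum_le_sum fun i _ => ?_
    have hmem := hq.mem_domain hw (hs.mem_domain hw i) t
    refine (realCost_sub_le_of_isMin hlog (hw i) hmem (hs.mem_domain hw i)
      (ρ := ρ) (z := (q t i).z) (la := la t i) fun q' hq' => ?_).trans
      (le_of_eq (Finset.sum_congr rfl fun j hj => ?_))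
    · have h := (hq.2.1 t i).2 q'.y q'.p hq'.1
      rw [FiniteCost.localLagrangian_eq
          (q := ((q (t + 1) i).y, (q (t + 1) i).p, (q t i).z)) hmem.2,
        FiniteCost.localLagrangian_eq (q := (q'.y, q'.p, (q t i).z)) hq'.2,
        EReal.coe_le_coe_iff] at h
      exact h
    · simp only [Pi.add_apply, Pi.smul_apply, Pi.sub_apply, hs.2.2.1 i j hj]
  · exact ((hz (t + 1)).sub hzs).pairing_eq_zero fun i j hj => hq.residual_antisymm t hj
  · exact ((hz t).sub hzs).pairing_eq_zero fun i j hj => hq.residual_antisymm t hj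
  · exact ((hz (t + 1)).sub hzs).pairing_eq_zero fun i j hj => hq.multiplier_antisymm t hj
  · exact hs.pairing_eq_zero hw ((hz (t + 1)).sub hzs)

theorem IsADMM.sum_totalGap_le (hlog : N.LogConcaveSensing)
    (hw : ∀ i, ∀ j ∈ N.nbr i, 0 ≤ w i j) (hρ : 0 < ρ) {qs : V → NodeVars V K D}
    {las : V → V → EdgeVec D} (hs : N.IsSolution w qs las) (hq : N.IsADMM w ρ q la) (t : ℕ) :
    ∑ κ ∈ Finset.Icc 1 t, N.totalGap w ρ qs las (q κ) ≤
      N.potential ρ qs las (q 0) (la 0) - N.potential ρ qs las (q t) (la t) := by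
  induction t with
  | zero => simp
  | succ t ih =>
    rw [Finset.sum_Icc_succ_top (by omega)]
    linarith [hq.totalGap_le hlog hw hρ hs t]

theorem IsADMM.potential_zero (hρ : 0 < ρ) (hq : N.IsADMM w ρ q la) (qs : V → NodeVars V K D)
    (las : V → V → EdgeVec D) :
    N.potential ρ qs las (q 0) (la 0) = 1 / (2 * ρ) * ∑ i, N.localError ρ qs las i := by
  have h1 : N.pairing (la 0 - las) (la 0 - las) = N.pairing (-las) (-las) := by
    apply pairing_congr <;> intro i j hj <;> simp [(hq.1 i j hj).2]
  have h2 : N.pairing ((fun i => (q 0 i).z) - fun i => (qs i).z)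
      ((fun i => (q 0 i).z) - fun i => (qs i).z) =
      N.pairing (-fun i => (qs i).z) (-fun i => (qs i).z) := by
    apply pairing_congr <;> intro i j hj <;> simp [(hq.1 i j hj).1]
  rw [potential, h1, h2, pairing_self, pairing_self]
  simp only [localError, Pi.neg_apply, norm_neg, Finset.sum_add_distrib, ← Finset.mul_sum]
  field_simp
  ring

omit [Fintype V] in
theorem runningAverage_eq (q : ℕ → V → NodeVars V K D) (t : ℕ) (i : V) :
    runningAverage q t i = ∑ κ ∈ Finset.Icc 1 t, (1 / (t : ℝ)) • q κ i :=
  Finset.smul_sum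

theorem IsADMM.runningAverage_mem_domain (hlog : N.LogConcaveSensing)
    (hw : ∀ i, ∀ j ∈ N.nbr i, 0 ≤ w i j) (hq : N.IsADMM w ρ q la) {i : V}
    {q₀ : NodeVars V K D} (h₀ : q₀ ∈ N.domain w i) {t : ℕ} (ht : 0 < t) :
    runningAverage q t i ∈ N.domain w i := by
  rw [runningAverage_eq]
  refine (convexOn_realCost hlog (hw i)).1.sum_mem (fun _ _ => by positivity) ?_ fun κ hκ => ?_
  · have : (t : ℝ) ≠ 0 := by positivity
    simp [this]
  · obtain ⟨k, rfl⟩ := Nat.exists_eq_succ_of_ne_zero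
      (Nat.one_le_iff_ne_zero.1 (Finset.mem_Icc.1 hκ).1)
    exact hq.mem_domain hw h₀ k

theorem IsADMM.sharedConsistent_runningAverage (hq : N.IsADMM w ρ q la) (t : ℕ) :
    N.SharedConsistent (runningAverage q t) := by
  have hz : ∀ i j, (runningAverage q t i).z j =
      (1 / (t : ℝ)) • ∑ κ ∈ Finset.Icc 1 t, (q κ i).z j := by
    intro i j
    simp [runningAverage, NodeVars.z, Prod.snd_sum, Finset.sum_apply]
  intro i j hj
  rw [hz, hz, map_smul, map_sum]
  congr 1
  exact Finset.sum_congr rfl fun κ _ => hq.sharedConsistent κ i j hj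

/-- Jensen for the convex local Lagrangians, then telescoping; the final potential is non-negative
and is dropped. -/
theorem IsADMM.totalGap_runningAverage_le (hlog : N.LogConcaveSensing)
    (hw : ∀ i, ∀ j ∈ N.nbr i, 0 ≤ w i j) (hρ : 0 < ρ) {qs : V → NodeVars V K D}
    {las : V → V → EdgeVec D} (hs : N.IsSolution w qs las) (hq : N.IsADMM w ρ q la) {t : ℕ}
    (ht : 0 < t) :
    N.totalGap w ρ qs las (runningAverage q t) ≤
      1 / (t : ℝ) * (1 / (2 * ρ) * ∑ i, N.localError ρ qs las i) := by
  have ht' : (t : ℝ) ≠ 0 := by positivity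
  have hone : ∑ κ ∈ Finset.Icc 1 t, 1 / (t : ℝ) = 1 := by simp [ht']
  have hJ : N.totalGap w ρ qs las (runningAverage q t) ≤
      1 / (t : ℝ) * ∑ κ ∈ Finset.Icc 1 t, N.totalGap w ρ qs las (q κ) := by
    simp only [totalGap]
    rw [Finset.sum_comm, Finset.mul_sum]
    refine Finset.sum_le_sum fun i _ => ?_
    have h := (convexOn_realLagrangian hlog (hw i) hρ.le (las i)).map_sum_le
      (t := Finset.Icc 1 t) (w := fun _ => 1 / (t : ℝ)) (p := fun κ => q κ i)
      (fun _ _ => by positivity) hone fun κ hκ => by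
        obtain ⟨k, rfl⟩ := Nat.exists_eq_succ_of_ne_zero
          (Nat.one_le_iff_ne_zero.1 (Finset.mem_Icc.1 hκ).1)
        exact hq.mem_domain hw (hs.mem_domain hw i) k
    rw [← runningAverage_eq] at h
    simp only [smul_eq_mul] at h
    rw [Finset.mul_sum]
    simp only [mul_sub, Finset.sum_sub_distrib]
    rw [← Finset.sum_mul, hone, one_mul]
    linarith
  refine hJ.trans (mul_le_mul_of_nonneg_left ?_ (by positivity))
  rw [← hq.potential_zero hρ]
  linarith [hq.sum_totalGap_le hlog hw hρ hs t,
    N.potential_nonneg hρ qs las (q t) (la t)]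

end ADMM

/-! ### The iteration count and the conclusion -/

theorem localError_nonneg (ρ : ℝ) (qs : V → NodeVars V K D) (las : V → V → EdgeVec D) (i : V) :
    0 ≤ N.localError ρ qs las i := by
  unfold localError
  positivity

theorem localError_add_one_le {ρ η : ℝ} {qs : V → NodeVars V K D} {las : V → V → EdgeVec D}
    {t : ℕ} (ht : N.iterationBound ρ η qs las ≤ t) (i : V) :
    1 / (2 * ρ * η) * N.localError ρ qs las i + 1 ≤ t :=
  Nat.ceil_le.1 ((Finset.le_sup
    (f := fun i => ⌈1 / (2 * ρ * η) * N.localError ρ qs las i + 1⌉₊)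
    (Finset.mem_univ i)).trans ht)

theorem iterationBound_eq {ρ η : ℝ} (hρ : 0 < ρ) (hη : 0 < η) {qs : V → NodeVars V K D}
    {las : V → V → EdgeVec D} {B : ℝ} (hB : IsGreatest (Set.range (N.localError ρ qs las)) B) :
    N.iterationBound ρ η qs las = ⌈1 / (2 * ρ * η) * B + 1⌉₊ := by
  obtain ⟨⟨i, rfl⟩, hub⟩ := hB
  refine le_antisymm (Finset.sup_le fun j _ => Nat.ceil_mono ?_) (Finset.le_sup
    (f := fun i => ⌈1 / (2 * ρ * η) * N.localError ρ qs las i + 1⌉₊) (Finset.mem_univ i))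
  have := hub ⟨j, rfl⟩
  gcongr

end Network
end SNL

theorem proposition2 {V K : Type*} [Fintype V] {D : ℕ} (N : SNL.Network V K D)
    (hlog : N.LogConcaveSensing) (hconn : N.graph.Connected)
    (w : V → V → ℝ) (hw : N.IsCostSplit w)
    (ρ : ℝ) (hρ : 0 < ρ) (η : ℝ) (hη : 0 < η)
    (qs : V → SNL.NodeVars V K D) (las : V → V → SNL.EdgeVec D) (hs : N.IsSolution w qs las)
    (q : ℕ → V → SNL.NodeVars V K D) (la : ℕ → V → V → SNL.EdgeVec D)
    (hq : N.IsADMM w ρ q la) :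
    (∀ t : ℕ, N.iterationBound ρ η qs las ≤ t →
      0 ≤ N.averageLocalGap w ρ (SNL.Network.runningAverage q t) qs las ∧
        N.averageLocalGap w ρ (SNL.Network.runningAverage q t) qs las ≤ (η : EReal)) ∧
    ∀ B : ℝ, IsGreatest (Set.range (N.localError ρ qs las)) B →
      N.iterationBound ρ η qs las = ⌈1 / (2 * ρ * η) * B + 1⌉₊ := by
  have hw' : ∀ i, ∀ j ∈ N.nbr i, 0 ≤ w i j := fun i j hj => (hw i j (N.mem_nbr.1 hj)).1
  refine ⟨fun t ht => ?_, fun B hB => SNL.Network.iterationBound_eq hρ hη hB⟩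
  have : Nonempty V := hconn.nonempty
  have hn : (0 : ℝ) < Fintype.card V := by exact_mod_cast Fintype.card_pos
  have hbound := SNL.Network.localError_add_one_le ht
  -- The `+ 1` in the iteration bound excludes `t = 0`, where the running average would be zero
  -- instead of a mean of iterates.
  have ht0 : 0 < t := by
    obtain ⟨i⟩ := this
    have h1 := hbound i
    have h2 : 0 ≤ 1 / (2 * ρ * η) * N.localError ρ qs las i :=
      mul_nonneg (by positivity) (SNL.Network.localError_nonneg ρ qs las i)
    have h3 : (0 : ℝ) < t := by linarith
    exact_mod_cast h3
  have htR : (0 : ℝ) < t := by exact_mod_cast ht0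
  have hdom := fun i => hq.runningAverage_mem_domain hlog hw' (hs.mem_domain hw' i) ht0
  -- Each node satisfies its own bound, so the sum costs a factor `Fintype.card V`, which the
  -- averaging cancels.
  have hsum : ∑ i, N.localError ρ qs las i ≤ Fintype.card V * (2 * ρ * η * t) := by
    refine (Finset.sum_le_card_nsmul Finset.univ _ (2 * ρ * η * t) fun i _ => ?_).trans_eq ?_
    · have h1 : 1 / (2 * ρ * η) * N.localError ρ qs las i ≤ t := by linarith [hbound i]
      rwa [one_div, inv_mul_le_iff₀ (by positivity)] at h1
    · rw [nsmul_eq_mul, Finset.card_univ]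
  have hle : N.totalGap w ρ qs las (SNL.Network.runningAverage q t) ≤ Fintype.card V * η := by
    refine (hq.totalGap_runningAverage_le hlog hw' hρ hs ht0).trans ?_
    calc 1 / (t : ℝ) * (1 / (2 * ρ) * ∑ i, N.localError ρ qs las i)
        ≤ 1 / (t : ℝ) * (1 / (2 * ρ) * (Fintype.card V * (2 * ρ * η * t))) := by gcongr
      _ = Fintype.card V * η := by field_simp
  rw [SNL.Network.averageLocalGap_eq las (fun i => (hdom i).2)
    fun i => (hs.mem_domain hw' i).2]
  constructor
  · rw [← EReal.coe_zero, EReal.coe_le_coe_iff]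
    exact mul_nonneg (by positivity)
      (hs.totalGap_nonneg hw' hρ.le hdom (hq.sharedConsistent_runningAverage t))
  · rw [EReal.coe_le_coe_iff, one_div, inv_mul_le_iff₀ hn]
    exact hle
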